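/- Let $X$ be a real random variable with the standard Cauchy distribution, i.e. with density $\frac{1}{\pi(1+x^2)}$ on $\mathbb{R}$, and for $t\ge 0$ let \[ \xi(t)=\ln(1+\sqrt{t})+\tfrac12\ln(1+t). \] Let $\lambda>0$. Then the expectations $\mu(\lambda):=\mathbb{E}\,\xi(\lambda|X|)$, $\mathbb{E}\,\xi^2(\lambda|X|)$ and $\mathbb{E}\ln(1+\lambda|X|)$ are finite, and the following bounds hold. 1. For every $\lambda>0$, \[ \mathbb{E}\,\xi^2(\lambda|X|)\le \min\left\{2\,\mathbb{E}\ln(1+\lambda|X|),\ \frac{\pi^2}{2}\right\}+\mu(\lambda)^2 . \] 2. If $0<\lambda\le 1$, then \[ \frac{\mathbb{E}\,\xi^2(\lambda|X|)}{\lambda}\le \lambda+\frac{4}{\pi}-\frac{4}{\pi}\ln\lambda+\frac{8}{(1+\lambda)^2}+2\lambda\,\frac{\sqrt{2\lambda}}{1+\lambda}+\frac{\lambda^3}{4}. \] 3. If $\lambda\ge 1$, then \[ \frac{\mathbb{E}\,\xi^2(\lambda|X|)}{\lambda}\le \frac{\pi^2}{2}+2+\lambda\sqrt{2}+\frac{\lambda^3}{4}.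 \] -/

import Mathlib

open MeasureTheory ProbabilityTheory

/-- The function `ξ(t) = ln(1 + √t) + (1/2) ln(1 + t)`, used for `t ≥ 0`. -/
noncomputable def xi (t : ℝ) : ℝ :=
  Real.log (1 + Real.sqrt t) + (1 / 2) * Real.log (1 + t)

/-! Put `a = √λ` and `s = √|X|`, so `s` has density `(2/π) w(s)`, `w(s) = 2s/(1+s⁴)`. For `F(z) =
log(1+az)`, holomorphic on the closed first quadrant, `ξ(λs²) = Re F(s) + Re F(is)` is the sum of
boundary values on the two edges. The form `2z dz/(1+z⁴)` gives both edges the weight `w`, and its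
only pole in the quadrant is `ζ = exp(iπ/4)`. Hence `∫ w(x)(G(x) + G(ix)) dx = π G(ζ)` for `G` of at
most linear growth (`integral_quadrant_boundary`).

With `G = F` this gives `μ = 2 Re F(ζ) = log(1 + √2 a + a²)`. With `G = F²`, use `(u+v)² ≤
2(u²+v²)`, `Re F(is)² = v² - arctan²(as)` and `Re F(ζ)² ≤ (Re F(ζ))²`: then `E ξ² ≤ (4/π) ∫ w(s)
arctan²(as) ds + μ²` (`integral_xi_sq_le`). Part 1 follows from `arctan² t ≤ log(1+t²)` and `arctan²
≤ π²/4`. The explicit bounds add `μ² ≤ 2λ` and, for `λ ≤ 1`, an estimate of `E log(1+λ|X|)`. -/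

open Filter Set Complex Topology

/-! ### The weight and its integrability -/

/-- The density `2 s / (1 + s ^ 4)`: up to the factor `2 / π`, the density of `√|X|` for a standard
Cauchy variable `X`. -/
noncomputable def sqrtCauchyWeight (s : ℝ) : ℝ := 2 * s / (1 + s ^ 4)

theorem continuous_sqrtCauchyWeight : Continuous sqrtCauchyWeight := by
  unfold sqrtCauchyWeight
  exact Continuous.div (by fun_prop) (by fun_prop) fun s => by positivity

theorem sqrtCauchyWeight_nonneg {s : ℝ} (hs : 0 ≤ s) : 0 ≤ sqrtCauchyWeight s := by
  unfold sqrtCauchyWeight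
  positivity

theorem one_add_mul_sqrtCauchyWeight_le (s : ℝ) :
    (1 + s) * sqrtCauchyWeight s ≤ 8 * (1 + s ^ 2)⁻¹ := by
  unfold sqrtCauchyWeight
  rw [← div_eq_mul_inv, mul_div_assoc', div_le_div_iff₀ (by positivity) (by positivity)]
  have h1 : s ≤ 1 + s ^ 4 := by nlinarith [sq_nonneg (s - 1), sq_nonneg (s ^ 2 - 1)]
  have h2 : s ^ 2 ≤ 1 + s ^ 4 := by nlinarith [sq_nonneg (s ^ 2 - 1)]
  have h3 : s ^ 3 ≤ 1 + s ^ 4 := by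
    nlinarith [sq_nonneg (s ^ 2 - s), sq_nonneg (s ^ 2 - 1)]
  nlinarith

/-- Since the weight decays like `s⁻³`, linear growth of `f` still leaves an integrable `s⁻²` tail.
-/
theorem integrableOn_sqrtCauchyWeight_smul {E : Type*} [NormedAddCommGroup E] [NormedSpace ℝ E]
    {f : ℝ → E} {C : ℝ} (hf : ContinuousOn f (Ici 0))
    (hC : ∀ s, 0 ≤ s → ‖f s‖ ≤ C * (1 + s)) :
    IntegrableOn (fun s => sqrtCauchyWeight s • f s) (Ioi 0) := by
  refine Integrable.mono' ((integrable_inv_one_add_sq.const_mul (8 * C)).integrableOn) ?_ ?_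
  · exact (continuous_sqrtCauchyWeight.continuousOn.smul
      (hf.mono Ioi_subset_Ici_self)).aestronglyMeasurable measurableSet_Ioi
  · refine (ae_restrict_iff' measurableSet_Ioi).2 (ae_of_all _ fun s hs => ?_)
    have hs0 : 0 ≤ s := (mem_Ioi.1 hs).le
    have hC0 : 0 ≤ C := by
      have := (norm_nonneg _).trans (hC 0 le_rfl)
      simpa using this
    have hw := sqrtCauchyWeight_nonneg hs0
    rw [norm_smul, Real.norm_of_nonneg hw]
    calc sqrtCauchyWeight s * ‖f s‖ ≤ sqrtCauchyWeight s * (C * (1 + s)) :=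
          mul_le_mul_of_nonneg_left (hC s hs0) hw
      _ = C * ((1 + s) * sqrtCauchyWeight s) := by ring
      _ ≤ C * (8 * (1 + s ^ 2)⁻¹) :=
          mul_le_mul_of_nonneg_left (one_add_mul_sqrtCauchyWeight_le s) hC0
      _ = 8 * C * (1 + s ^ 2)⁻¹ := by ring

theorem integrableOn_sqrtCauchyWeight : IntegrableOn sqrtCauchyWeight (Ioi 0) := by
  have := integrableOn_sqrtCauchyWeight_smul (f := fun _ => (1 : ℝ)) (C := 1)
    continuousOn_const (fun s hs => by simpa using hs)
  simpa using this

theorem integral_sqrtCauchyWeight : ∫ s in Ioi 0, sqrtCauchyWeight s = Real.pi / 2 := by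
  have h := integral_Ioi_of_hasDerivAt_of_tendsto (a := 0) (f := fun s : ℝ => Real.arctan (s ^ 2))
    (f' := sqrtCauchyWeight) (m := Real.pi / 2) (by fun_prop) ?_ integrableOn_sqrtCauchyWeight ?_
  · simpa using h
  · intro s _
    have := (hasDerivAt_pow 2 s).arctan
    refine this.congr_deriv ?_
    unfold sqrtCauchyWeight
    simp only [← pow_mul]
    norm_num
    ring
  · exact (tendsto_nhds_of_tendsto_nhdsWithin Real.tendsto_arctan_atTop).comp
      (tendsto_pow_atTop two_ne_zero)

/-! ### Cauchy's formula on the first quadrant -/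

/-- The primitive eighth root of unity `exp (iπ/4)`. -/
noncomputable def zetaEight : ℂ := ⟨Real.sqrt 2 / 2, Real.sqrt 2 / 2⟩

theorem zetaEight_sq : zetaEight ^ 2 = I := by
  have h : Real.sqrt 2 * Real.sqrt 2 = 2 := Real.mul_self_sqrt (by norm_num)
  apply Complex.ext <;> simp [zetaEight, pow_two]
  linarith

theorem zetaEight_re_pos : 0 < zetaEight.re := by
  simp [zetaEight]

theorem zetaEight_im_pos : 0 < zetaEight.im := by
  simp [zetaEight]

/-- The kernel `2 s (F s - F ζ) / (1 + s ^ 4)` with its singularity at `ζ = exp (iπ/4)` removed. -/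
noncomputable def quadrantKernel (F : ℂ → ℂ) (s : ℂ) : ℂ :=
  2 * s * dslope F zetaEight s / ((s + zetaEight) * (s ^ 2 + I))

/-- The three roots of `1 + s⁴` other than `ζ` lie outside the closed first quadrant. -/
theorem quadrant_denominator_ne_zero {s : ℂ} (h1 : 0 ≤ s.re) (h2 : 0 ≤ s.im) :
    (s + zetaEight) * (s ^ 2 + I) ≠ 0 := by
  refine mul_ne_zero (fun h => ?_) (fun h => ?_)
  · have := congrArg Complex.re h
    simp only [add_re, zero_re] at this
    linarith [zetaEight_re_pos]
  · have := congrArg Complex.im h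
    simp only [pow_two, add_im, mul_im, I_im, zero_im] at this
    nlinarith [mul_nonneg h1 h2]

theorem quadrantKernel_of_ne {F : ℂ → ℂ} {s : ℂ} (h1 : 0 ≤ s.re) (h2 : 0 ≤ s.im)
    (h : s ≠ zetaEight) :
    quadrantKernel F s = 2 * s / (1 + s ^ 4) * (F s - F zetaEight) := by
  have hne : s - zetaEight ≠ 0 := sub_ne_zero.2 h
  have hd := quadrant_denominator_ne_zero h1 h2
  have key : 1 + s ^ 4 = (s - zetaEight) * ((s + zetaEight) * (s ^ 2 + I)) := by
    have : (s - zetaEight) * ((s + zetaEight) * (s ^ 2 + I)) = s ^ 4 - zetaEight ^ 2 * I +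
      s ^ 2 * (I - zetaEight ^ 2) := by ring
    rw [this, zetaEight_sq, I_mul_I]
    ring
  rw [quadrantKernel, dslope_of_ne _ h, slope_def_field, key]
  field_simp

theorem continuousAt_quadrantKernel {F : ℂ → ℂ} {s : ℂ} (h1 : 0 ≤ s.re) (h2 : 0 ≤ s.im)
    (hs : DifferentiableAt ℂ F s) : ContinuousAt (quadrantKernel F) s := by
  unfold quadrantKernel
  refine ContinuousAt.div (ContinuousAt.mul (by fun_prop) ?_) (by fun_prop)
    (quadrant_denominator_ne_zero h1 h2)
  by_cases h : s = zetaEight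
  · subst h
    exact continuousAt_dslope_same.2 hs
  · exact (continuousAt_dslope_of_ne h).2 hs.continuousAt

theorem differentiableAt_quadrantKernel {F : ℂ → ℂ} {s : ℂ} (h1 : 0 ≤ s.re) (h2 : 0 ≤ s.im)
    (h : s ≠ zetaEight) (hs : DifferentiableAt ℂ F s) :
    DifferentiableAt ℂ (quadrantKernel F) s := by
  unfold quadrantKernel
  exact DifferentiableAt.div (DifferentiableAt.mul (by fun_prop)
    ((differentiableAt_dslope_of_ne h).2 hs)) (by fun_prop) (quadrant_denominator_ne_zero h1 h2)

theorem norm_quadrantKernel_le {F : ℂ → ℂ} {C R : ℝ} (hR : 2 ≤ R) {s : ℂ} (h1 : 0 ≤ s.re)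
    (h2 : 0 ≤ s.im) (hRs : R ≤ ‖s‖) (hsR : ‖s‖ ≤ 2 * R) (hC : ‖F s‖ ≤ C * (1 + ‖s‖)) :
    ‖quadrantKernel F s‖ ≤ 8 * (3 * C + ‖F zetaEight‖) / R ^ 2 := by
  have hne : s ≠ zetaEight := by
    rintro rfl
    have h := congrArg norm zetaEight_sq
    rw [norm_pow, norm_I] at h
    nlinarith
  have hC0 : 0 ≤ C := by
    by_contra hneg
    have := (norm_nonneg _).trans hC
    nlinarith [norm_nonneg s]
  -- `R ≥ 2` gives `R⁴ ≥ 16`, so subtracting `1` costs less than half.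
  have hden : R ^ 4 / 2 ≤ ‖1 + s ^ 4‖ := by
    have h := norm_sub_le (1 + s ^ 4) 1
    rw [add_sub_cancel_left, norm_pow, norm_one] at h
    have h4 : R ^ 4 ≤ ‖s‖ ^ 4 := by gcongr
    have h5 : (2 : ℝ) ^ 4 ≤ R ^ 4 := by gcongr
    linarith
  have hnum : ‖F s - F zetaEight‖ ≤ (3 * C + ‖F zetaEight‖) * R := by
    have h := norm_sub_le (F s) (F zetaEight)
    have h' : C * (1 + ‖s‖) ≤ C * (3 * R) := by gcongr; linarith
    nlinarith [norm_nonneg (F zetaEight)]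
  have hR0 : 0 < R := by linarith
  rw [quadrantKernel_of_ne h1 h2 hne, norm_mul, norm_div, norm_mul, Complex.norm_ofNat]
  calc 2 * ‖s‖ / ‖1 + s ^ 4‖ * ‖F s - F zetaEight‖
      ≤ 2 * (2 * R) / (R ^ 4 / 2) * ((3 * C + ‖F zetaEight‖) * R) := by gcongr
    _ = 8 * (3 * C + ‖F zetaEight‖) / R ^ 2 := by field_simp; ring

theorem quadrantKernel_ofReal {F : ℂ → ℂ} {x : ℝ} (hx : 0 ≤ x) :
    quadrantKernel F x = sqrtCauchyWeight x • (F x - F zetaEight) := by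
  rw [quadrantKernel_of_ne (by simpa) (by simp)]
  · simp [sqrtCauchyWeight]
  · intro h
    have := congrArg Complex.im h
    rw [ofReal_im] at this
    exact zetaEight_im_pos.ne this

/-- Here `(ix)⁴ = x⁴` and `i · 2ix = -2x`; the sign cancels the downward orientation of the
imaginary edge, so both edges carry the same positive weight. -/
theorem quadrantKernel_ofReal_mul_I {F : ℂ → ℂ} {x : ℝ} (hx : 0 ≤ x) :
    I * quadrantKernel F (x * I) = -(sqrtCauchyWeight x • (F (x * I) - F zetaEight)) := by
  rw [quadrantKernel_of_ne (by simp) (by simpa)]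
  · simp only [mul_pow, I_pow_four, mul_one, sqrtCauchyWeight, real_smul, ofReal_div, ofReal_mul,
      ofReal_ofNat, ofReal_add, ofReal_one, ofReal_pow]
    linear_combination (2 * (x : ℂ) / (1 + (x : ℂ) ^ 4) * (F (x * I) - F zetaEight)) * I_mul_I
  · intro h
    have := congrArg Complex.re h
    simp only [mul_re, ofReal_re, I_re, mul_zero, ofReal_im, I_im, mul_one, sub_zero] at this
    exact zetaEight_re_pos.ne this

/-- On the square of side `R` the two far sides have total length `2R` and the kernel there is
`O(R⁻²)`. -/
theorem norm_quadrant_boundary_le {F : ℂ → ℂ} {C R : ℝ}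
    (hF : ∀ s : ℂ, 0 ≤ s.re → 0 ≤ s.im → DifferentiableAt ℂ F s)
    (hC : ∀ s : ℂ, 0 ≤ s.re → 0 ≤ s.im → ‖F s‖ ≤ C * (1 + ‖s‖)) (hR : 2 ≤ R) :
    ‖(∫ x in (0 : ℝ)..R, sqrtCauchyWeight x • (F x - F zetaEight)) +
      ∫ x in (0 : ℝ)..R, sqrtCauchyWeight x • (F (x * I) - F zetaEight)‖ ≤
      16 * (3 * C + ‖F zetaEight‖) * R⁻¹ := by
  have hR0 : 0 < R := by linarith
  -- At `ζ` only continuity of the kernel is needed, which `dslope` supplies.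
  have hrect := integral_boundary_rect_eq_zero_of_differentiable_on_off_countable
    (quadrantKernel F) 0 (R + R * I) {zetaEight} (countable_singleton _) ?_ ?_
  · simp only [zero_re, zero_im, add_re, ofReal_re, mul_re, I_re, mul_zero, ofReal_im, I_im,
      mul_one, sub_self, add_zero, add_im, mul_im, zero_add, ofReal_zero, zero_mul,
      smul_eq_mul] at hrect
    have e1 : ∫ x in (0 : ℝ)..R, quadrantKernel F x =
        ∫ x in (0 : ℝ)..R, sqrtCauchyWeight x • (F x - F zetaEight) := by
      refine intervalIntegral.integral_congr fun x hx => ?_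
      rw [uIcc_of_le hR0.le] at hx
      exact quadrantKernel_ofReal hx.1
    have e2 : I * ∫ x in (0 : ℝ)..R, quadrantKernel F (x * I) =
        -∫ x in (0 : ℝ)..R, sqrtCauchyWeight x • (F (x * I) - F zetaEight) := by
      rw [← intervalIntegral.integral_const_mul, ← intervalIntegral.integral_neg]
      refine intervalIntegral.integral_congr fun x hx => ?_
      rw [uIcc_of_le hR0.le] at hx
      exact quadrantKernel_ofReal_mul_I hx.1
    rw [e1, e2] at hrect
    have hside : ∀ s : ℂ, 0 ≤ s.re → 0 ≤ s.im → s.re ≤ R → s.im ≤ R → (s.re = R ∨ s.im = R) →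
        ‖quadrantKernel F s‖ ≤ 8 * (3 * C + ‖F zetaEight‖) / R ^ 2 := by
      intro s h1 h2 h3 h4 h5
      refine norm_quadrantKernel_le hR h1 h2 ?_ ?_ (hC s h1 h2)
      · rcases h5 with h | h
        · exact h ▸ re_le_norm s
        · exact h ▸ im_le_norm s
      · have := norm_le_abs_re_add_abs_im s
        rw [abs_of_nonneg h1, abs_of_nonneg h2] at this
        linarith
    have b1 := intervalIntegral.norm_integral_le_of_norm_le_const (a := (0 : ℝ)) (b := R)
      (f := fun x : ℝ => quadrantKernel F (x + R * I))
      (C := 8 * (3 * C + ‖F zetaEight‖) / R ^ 2) (by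
        intro x hx
        rw [uIoc_of_le hR0.le] at hx
        apply hside <;> simp [hx.1.le, hx.2, hR0.le])
    have b2 := intervalIntegral.norm_integral_le_of_norm_le_const (a := (0 : ℝ)) (b := R)
      (f := fun y : ℝ => quadrantKernel F (R + y * I))
      (C := 8 * (3 * C + ‖F zetaEight‖) / R ^ 2) (by
        intro x hx
        rw [uIoc_of_le hR0.le] at hx
        apply hside <;> simp [hx.1.le, hx.2, hR0.le])
    have e3 : (∫ x in (0 : ℝ)..R, sqrtCauchyWeight x • (F x - F zetaEight)) +
        ∫ x in (0 : ℝ)..R, sqrtCauchyWeight x • (F (x * I) - F zetaEight) =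
        (∫ x in (0 : ℝ)..R, quadrantKernel F (x + R * I)) -
          I * ∫ y in (0 : ℝ)..R, quadrantKernel F (R + y * I) := by
      linear_combination hrect
    rw [e3]
    refine (norm_sub_le _ _).trans ?_
    rw [norm_mul, norm_I, one_mul]
    refine (add_le_add b1 b2).trans (le_of_eq ?_)
    rw [sub_zero, abs_of_pos hR0]
    field_simp
    ring
  · intro s hs
    have h : s.re ∈ Icc 0 R ∧ s.im ∈ Icc 0 R := by
      simpa [mem_reProdIm, uIcc_of_le hR0.le] using hs
    exact (continuousAt_quadrantKernel h.1.1 h.2.1 (hF s h.1.1 h.2.1)).continuousWithinAt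
  · intro s hs
    have h : (s.re ∈ Ioo 0 R ∧ s.im ∈ Ioo 0 R) ∧ s ≠ zetaEight := by
      simpa [mem_reProdIm, hR0.le] using hs
    exact differentiableAt_quadrantKernel h.1.1.1.le h.1.2.1.le h.2 (hF s h.1.1.1.le h.1.2.1.le)

theorem integrableOn_quadrant_real {F : ℂ → ℂ} {C : ℝ}
    (hF : ∀ s : ℂ, 0 ≤ s.re → 0 ≤ s.im → DifferentiableAt ℂ F s)
    (hC : ∀ s : ℂ, 0 ≤ s.re → 0 ≤ s.im → ‖F s‖ ≤ C * (1 + ‖s‖)) :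
    IntegrableOn (fun x : ℝ => sqrtCauchyWeight x • F x) (Ioi 0) := by
  refine integrableOn_sqrtCauchyWeight_smul (C := C) (fun x hx => ?_) (fun x hx => ?_)
  · exact (ContinuousAt.comp (f := fun x : ℝ => (x : ℂ))
      (hF x (by simpa using hx) (by simp)).continuousAt (by fun_prop)).continuousWithinAt
  · simpa [abs_of_nonneg hx] using hC x (by simpa using hx) (by simp)

theorem integrableOn_quadrant_imag {F : ℂ → ℂ} {C : ℝ}
    (hF : ∀ s : ℂ, 0 ≤ s.re → 0 ≤ s.im → DifferentiableAt ℂ F s)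
    (hC : ∀ s : ℂ, 0 ≤ s.re → 0 ≤ s.im → ‖F s‖ ≤ C * (1 + ‖s‖)) :
    IntegrableOn (fun x : ℝ => sqrtCauchyWeight x • F (x * I)) (Ioi 0) := by
  refine integrableOn_sqrtCauchyWeight_smul (f := fun x : ℝ => F (x * I)) (C := C)
    (fun x hx => ?_) (fun x hx => ?_)
  · exact (ContinuousAt.comp (f := fun x : ℝ => (x * I : ℂ))
      (hF (x * I) (by simp) (by simpa using hx)).continuousAt (by fun_prop)).continuousWithinAt
  · simpa [abs_of_nonneg hx] using hC (x * I) (by simp) (by simpa using hx)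

/-- Cauchy's integral formula on the first quadrant with respect to `2 s / (1 + s ^ 4)`. -/
theorem integral_quadrant_boundary {F : ℂ → ℂ} {C : ℝ}
    (hF : ∀ s : ℂ, 0 ≤ s.re → 0 ≤ s.im → DifferentiableAt ℂ F s)
    (hC : ∀ s : ℂ, 0 ≤ s.re → 0 ≤ s.im → ‖F s‖ ≤ C * (1 + ‖s‖)) :
    (∫ x in Ioi (0 : ℝ), sqrtCauchyWeight x • F x) +
      ∫ x in Ioi (0 : ℝ), sqrtCauchyWeight x • F (x * I) = Real.pi * F zetaEight := by
  have i1 := integrableOn_quadrant_real hF hC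
  have i2 := integrableOn_quadrant_imag hF hC
  have ic : IntegrableOn (fun x : ℝ => sqrtCauchyWeight x • F zetaEight) (Ioi 0) :=
    integrableOn_sqrtCauchyWeight.smul_const _
  have hlim := (intervalIntegral_tendsto_integral_Ioi 0 (i1.sub ic) tendsto_id).add
    (intervalIntegral_tendsto_integral_Ioi 0 (i2.sub ic) tendsto_id)
  have hzero : Tendsto (fun R : ℝ =>
      (∫ x in (0 : ℝ)..R, sqrtCauchyWeight x • (F x - F zetaEight)) +
      ∫ x in (0 : ℝ)..R, sqrtCauchyWeight x • (F (x * I) - F zetaEight)) atTop (𝓝 0) := by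
    refine squeeze_zero_norm' (a := fun R => 16 * (3 * C + ‖F zetaEight‖) * R⁻¹) ?_ ?_
    · filter_upwards [eventually_ge_atTop 2] with R hR
      exact norm_quadrant_boundary_le hF hC hR
    · simpa using tendsto_inv_atTop_zero.const_mul (16 * (3 * C + ‖F zetaEight‖))
  simp only [smul_sub] at hzero
  have huniq := tendsto_nhds_unique hlim hzero
  simp only [Pi.sub_apply] at huniq
  rw [integral_sub i1 ic, integral_sub i2 ic, integral_smul_const, integral_sqrtCauchyWeight]
    at huniq
  simp only [real_smul] at huniq ⊢
  push_cast at huniq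
  linear_combination huniq

theorem integral_quadrant_boundary_re {F : ℂ → ℂ} {C : ℝ}
    (hF : ∀ s : ℂ, 0 ≤ s.re → 0 ≤ s.im → DifferentiableAt ℂ F s)
    (hC : ∀ s : ℂ, 0 ≤ s.re → 0 ≤ s.im → ‖F s‖ ≤ C * (1 + ‖s‖)) :
    (∫ x in Ioi (0 : ℝ), sqrtCauchyWeight x • (F x).re) +
      ∫ x in Ioi (0 : ℝ), sqrtCauchyWeight x • (F (x * I)).re = Real.pi * (F zetaEight).re := by
  have h := congrArg Complex.re (integral_quadrant_boundary hF hC)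
  rw [add_re, re_ofReal_mul] at h
  rw [← h]
  congr 1
  · simpa using integral_re (𝕜 := ℂ) (integrableOn_quadrant_real hF hC)
  · simpa using integral_re (𝕜 := ℂ) (integrableOn_quadrant_imag hF hC)

/-! ### Cauchy expectations as weighted integrals -/

theorem integrable_comp_abs_of_integrableOn_Ioi {f : ℝ → ℝ} (hf : IntegrableOn f (Ioi 0)) :
    Integrable fun x => f |x| := by
  have h1 : IntegrableOn (fun x => f |x|) (Ioi 0) :=
    hf.congr_fun (fun x hx => by rw [abs_of_pos hx]) measurableSet_Ioi
  have h2 : IntegrableOn (fun x => f |x|) (Iic 0) := by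
    have h := (integrableOn_Ici_iff_integrableOn_Ioi).2 h1
    have h' := h.comp_neg
    simpa using h'
  have := h2.union h1
  rwa [Iic_union_Ioi, integrableOn_univ] at this

theorem cauchyPDFReal_abs (x : ℝ) : cauchyPDFReal 0 1 |x| = cauchyPDFReal 0 1 x := by
  simp [cauchyPDFReal]

theorem two_mul_cauchyPDFReal_sq (s : ℝ) :
    2 * s * cauchyPDFReal 0 1 (s ^ 2) = Real.pi⁻¹ * sqrtCauchyWeight s := by
  simp only [cauchyPDFReal, sqrtCauchyWeight, sub_zero, NNReal.coe_one, one_pow, mul_one,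
    ← pow_mul]
  rw [div_eq_mul_inv, add_comm (1 : ℝ)]
  ring

section

variable {Ω : Type*} [MeasurableSpace Ω] {P : Measure Ω} {X : Ω → ℝ}

theorem integrable_comp_abs_cauchy (hX : HasLaw X (cauchyMeasure 0 1) P) {f : ℝ → ℝ}
    (hi : IntegrableOn (fun s => sqrtCauchyWeight s • f (s ^ 2)) (Ioi 0)) :
    Integrable (fun ω => f |X ω|) P := by
  have h0 : IntegrableOn (fun x => cauchyPDFReal 0 1 x * f x) (Ioi 0) := by
    rw [← integrableOn_Ioi_comp_rpow_iff _ (two_ne_zero' ℝ)]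
    refine IntegrableOn.congr_fun (hi.const_mul Real.pi⁻¹) (fun s hs => ?_) measurableSet_Ioi
    have := two_mul_cauchyPDFReal_sq s
    norm_num
    linear_combination -(f (s ^ 2)) * this
  have h1 := integrable_comp_abs_of_integrableOn_Ioi h0
  have h2 : Integrable (fun x => f |x|) (cauchyMeasure 0 1) := by
    rw [cauchyMeasure_of_scale_ne_zero _ one_ne_zero,
      integrable_withDensity_iff_integrable_smul' (measurable_cauchyPDF 0 1)
        (ae_of_all _ fun x => ENNReal.ofReal_lt_top)]
    refine h1.congr (ae_of_all _ fun x => ?_)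
    simp [cauchyPDFReal_abs, cauchyPDF, ENNReal.toReal_ofReal (cauchyPDF_pos 0 one_ne_zero x).le]
  rw [← hX.map_eq] at h2
  exact h2.comp_aemeasurable hX.aemeasurable

/-- Evenness of the density gives the factor `2`; the substitution `x = s²` turns it into the
weight. -/
theorem integral_comp_abs_cauchy (hX : HasLaw X (cauchyMeasure 0 1) P) {f : ℝ → ℝ}
    (hf : Measurable f) :
    ∫ ω, f |X ω| ∂P = 2 / Real.pi * ∫ s in Ioi 0, sqrtCauchyWeight s • f (s ^ 2) := by
  have h1 : ∫ ω, f |X ω| ∂P = ∫ x, f |x| ∂(cauchyMeasure 0 1) :=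
    hX.integral_comp (f := fun x => f |x|)
      (hf.comp measurable_norm).aestronglyMeasurable
  rw [h1, cauchyMeasure_of_scale_ne_zero _ one_ne_zero,
    integral_withDensity_eq_integral_toReal_smul (measurable_cauchyPDF 0 1)
      (ae_of_all _ fun x => ENNReal.ofReal_lt_top)]
  have h2 : ∀ x : ℝ, (cauchyPDF 0 1 x).toReal • f |x| =
      (fun y => cauchyPDFReal 0 1 y * f y) |x| := fun x => by
    simp [cauchyPDFReal_abs, cauchyPDF, ENNReal.toReal_ofReal (cauchyPDF_pos 0 one_ne_zero x).le]
  simp_rw [h2]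
  rw [integral_comp_abs (f := fun y => cauchyPDFReal 0 1 y * f y),
    ← integral_comp_rpow_Ioi_of_pos (two_pos : (0 : ℝ) < 2), div_eq_mul_inv, mul_assoc,
    ← integral_const_mul Real.pi⁻¹]
  congr 1
  refine setIntegral_congr_fun measurableSet_Ioi fun s hs => ?_
  have := two_mul_cauchyPDFReal_sq s
  norm_num
  linear_combination (f (s ^ 2)) * this

end

/-! ### The logarithm on the quadrant -/

theorem arctan_sq_le_log_one_add_sq {t : ℝ} (ht : 0 ≤ t) :
    Real.arctan t ^ 2 ≤ Real.log (1 + t ^ 2) := by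
  have hd : ∀ x : ℝ, HasDerivAt (fun x => Real.log (1 + x ^ 2) - Real.arctan x ^ 2)
      (2 * (x - Real.arctan x) / (1 + x ^ 2)) x := fun x => by
    have h0 : 1 + x ^ 2 ≠ 0 := by positivity
    refine ((((hasDerivAt_pow 2 x).const_add 1).log h0).sub
      ((Real.hasDerivAt_arctan x).pow 2)).congr_deriv ?_
    field_simp
    simp
  have hmono : MonotoneOn (fun x => Real.log (1 + x ^ 2) - Real.arctan x ^ 2) (Ici 0) := by
    refine monotoneOn_of_deriv_nonneg (convex_Ici 0)
      (fun x _ => (hd x).continuousAt.continuousWithinAt)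
      (fun x _ => (hd x).differentiableAt.differentiableWithinAt) (fun x hx => ?_)
    rw [(hd x).deriv]
    rw [interior_Ici, mem_Ioi] at hx
    have h := Real.le_tan (Real.arctan_nonneg.2 hx.le) (Real.arctan_lt_pi_div_two x)
    rw [Real.tan_arctan] at h
    have : 0 ≤ x - Real.arctan x := by linarith
    positivity
  have h := hmono (mem_Ici.2 le_rfl) (mem_Ici.2 ht) ht
  simpa using h

theorem log_one_add_ofReal_mul_I_re (t : ℝ) :
    (Complex.log (1 + t * I)).re = 1 / 2 * Real.log (1 + t ^ 2) := by
  have h : ‖(1 + t * I : ℂ)‖ = Real.sqrt (1 + t ^ 2) := by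
    simpa using norm_add_mul_I 1 t
  rw [log_re, h, Real.log_sqrt (by positivity)]
  ring

theorem log_one_add_ofReal_mul_I_im (t : ℝ) :
    (Complex.log (1 + t * I)).im = Real.arctan t := by
  have h : ‖(1 + t * I : ℂ)‖ = Real.sqrt (1 + t ^ 2) := by
    simpa using norm_add_mul_I 1 t
  rw [log_im, arg_of_re_nonneg (by simp), h, Real.arctan_eq_arcsin]
  simp

theorem two_mul_log_one_add_mul_zetaEight_re (a : ℝ) :
    2 * (Complex.log (1 + a * zetaEight)).re = Real.log (1 + Real.sqrt 2 * a + a ^ 2) := by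
  have h : ‖(1 + a * zetaEight : ℂ)‖ ^ 2 = 1 + Real.sqrt 2 * a + a ^ 2 := by
    have h2 : Real.sqrt 2 * Real.sqrt 2 = 2 := Real.mul_self_sqrt (by norm_num)
    rw [← normSq_eq_norm_sq, normSq_apply]
    simp [zetaEight]
    linear_combination (a ^ 2 / 2) * h2
  rw [log_re, ← h, Real.log_pow]
  norm_num

section

variable {a : ℝ}

theorem differentiableAt_log_one_add_mul (ha : 0 < a) {s : ℂ} (h1 : 0 ≤ s.re) :
    DifferentiableAt ℂ (fun s : ℂ => Complex.log (1 + a * s)) s := by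
  refine DifferentiableAt.clog (by fun_prop) (Or.inl ?_)
  simp
  positivity

theorem norm_log_one_add_mul_sq_le (ha : 0 < a) {s : ℂ} (h1 : 0 ≤ s.re) :
    ‖Complex.log (1 + a * s)‖ ^ 2 ≤ 40 * (1 + a) * (1 + ‖s‖) := by
  set y := 1 + a * ‖s‖ with hy
  have hy1 : 1 ≤ y := by rw [hy]; linarith [mul_nonneg ha.le (norm_nonneg s)]
  have hge : 1 ≤ ‖1 + a * s‖ := by
    have h := re_le_norm (1 + a * s)
    simp at h
    nlinarith [mul_nonneg ha.le h1]
  have hle : ‖1 + a * s‖ ≤ y := by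
    refine (norm_add_le _ _).trans ?_
    simp [hy, abs_of_pos ha]
  have hlog : Real.log ‖1 + a * s‖ ≤ 2 * Real.sqrt y := by
    have h := Real.log_le_self (Real.sqrt_nonneg y)
    rw [Real.log_sqrt (by linarith)] at h
    linarith [Real.log_le_log (by linarith) hle]
  have hn : ‖Complex.log (1 + a * s)‖ ≤ 2 * Real.sqrt y + 4 := by
    have h := norm_le_abs_re_add_abs_im (Complex.log (1 + a * s))
    rw [log_re, log_im, abs_of_nonneg (Real.log_nonneg hge)] at h
    linarith [abs_arg_le_pi (1 + a * s), Real.pi_le_four]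
  have hsq := Real.sq_sqrt (by linarith : 0 ≤ y)
  have hs0 := Real.sqrt_nonneg y
  have hyb : y ≤ (1 + a) * (1 + ‖s‖) := by
    rw [hy]
    nlinarith [norm_nonneg s]
  -- `(2√y + 4)² ≤ 8y + 32 ≤ 40y`, as `y ≥ 1`.
  nlinarith [norm_nonneg (Complex.log (1 + a * s)), sq_nonneg (2 * Real.sqrt y - 4)]

theorem norm_log_one_add_mul_le (ha : 0 < a) {s : ℂ} (h1 : 0 ≤ s.re) :
    ‖Complex.log (1 + a * s)‖ ≤ 40 * (1 + a) * (1 + ‖s‖) := by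
  have h := norm_log_one_add_mul_sq_le ha h1
  have h1 : 1 ≤ 40 * (1 + a) * (1 + ‖s‖) := by
    nlinarith [norm_nonneg s, mul_nonneg ha.le (norm_nonneg s)]
  nlinarith [norm_nonneg (Complex.log (1 + a * s))]

/-! ### The first two moments of `ξ` -/

theorem xi_sq_mul_sq (ha : 0 < a) {s : ℝ} (hs : 0 ≤ s) :
    xi (a ^ 2 * s ^ 2) = (Complex.log (1 + a * s)).re + (Complex.log (1 + a * (s * I))).re := by
  rw [← mul_assoc, ← ofReal_mul, log_one_add_ofReal_mul_I_re, ← ofReal_one, ← ofReal_add,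
    log_ofReal_re, xi, ← mul_pow, Real.sqrt_sq (by positivity)]

theorem measurable_xi : Measurable xi := by
  unfold xi
  fun_prop

theorem continuousOn_xi : ContinuousOn xi (Ici 0) := by
  unfold xi
  refine ContinuousOn.add (ContinuousOn.log (by fun_prop) fun t ht => ?_)
    (continuousOn_const.mul (ContinuousOn.log (by fun_prop) fun t ht => ?_))
  · positivity
  · have : 0 ≤ t := ht
    positivity

theorem xi_sq_mul_sq_sq_le (ha : 0 < a) {s : ℝ} (hs : 0 ≤ s) :
    xi (a ^ 2 * s ^ 2) ^ 2 ≤ 160 * (1 + a) * (1 + s) := by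
  have h1 := norm_log_one_add_mul_sq_le ha (s := s) (by simpa)
  have h2 := norm_log_one_add_mul_sq_le ha (s := s * I) (by simp)
  have h3 := sq_le_sq' (neg_le_of_abs_le (abs_re_le_norm (Complex.log (1 + a * s))))
    (re_le_norm (Complex.log (1 + a * s)))
  have h4 := sq_le_sq' (neg_le_of_abs_le (abs_re_le_norm (Complex.log (1 + a * (s * I)))))
    (re_le_norm (Complex.log (1 + a * (s * I))))
  simp only [norm_real, Real.norm_of_nonneg hs, norm_mul, norm_I, mul_one] at h1 h2
  rw [xi_sq_mul_sq ha hs]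
  nlinarith [sq_nonneg ((Complex.log (1 + a * s)).re - (Complex.log (1 + a * (s * I))).re)]

theorem continuousOn_xi_sq_mul_sq : ContinuousOn (fun s => xi (a ^ 2 * s ^ 2)) (Ici 0) :=
  continuousOn_xi.comp (f := fun s : ℝ => a ^ 2 * s ^ 2) (by fun_prop)
    fun s _ => mem_Ici.2 (by positivity)

theorem integrableOn_xi_sq (ha : 0 < a) :
    IntegrableOn (fun s => sqrtCauchyWeight s • xi (a ^ 2 * s ^ 2) ^ 2) (Ioi 0) := by
  refine integrableOn_sqrtCauchyWeight_smul (C := 160 * (1 + a))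
    (continuousOn_xi_sq_mul_sq.pow 2) (fun s hs => ?_)
  rw [Real.norm_of_nonneg (sq_nonneg _)]
  exact xi_sq_mul_sq_sq_le ha hs

theorem integrableOn_xi (ha : 0 < a) :
    IntegrableOn (fun s => sqrtCauchyWeight s • xi (a ^ 2 * s ^ 2)) (Ioi 0) := by
  refine integrableOn_sqrtCauchyWeight_smul (C := 160 * (1 + a))
    continuousOn_xi_sq_mul_sq (fun s hs => ?_)
  have h := xi_sq_mul_sq_sq_le ha hs
  rw [← sq_abs] at h
  rw [Real.norm_eq_abs]
  have h1 : 1 ≤ 160 * (1 + a) * (1 + s) := by nlinarith [mul_nonneg ha.le hs]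
  nlinarith [abs_nonneg (xi (a ^ 2 * s ^ 2))]

theorem integrableOn_arctan_sq (a : ℝ) :
    IntegrableOn (fun s => sqrtCauchyWeight s • Real.arctan (a * s) ^ 2) (Ioi 0) := by
  refine integrableOn_sqrtCauchyWeight_smul (C := Real.pi ^ 2 / 4) (by fun_prop) (fun s hs => ?_)
  rw [Real.norm_of_nonneg (sq_nonneg _)]
  have h := sq_le_sq' (Real.neg_pi_div_two_lt_arctan (a * s)).le
    (Real.arctan_lt_pi_div_two (a * s)).le
  nlinarith [mul_nonneg (sq_nonneg Real.pi) hs]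

theorem integral_xi (ha : 0 < a) :
    ∫ s in Ioi 0, sqrtCauchyWeight s • xi (a ^ 2 * s ^ 2) =
      Real.pi / 2 * Real.log (1 + Real.sqrt 2 * a + a ^ 2) := by
  have hF : ∀ s : ℂ, 0 ≤ s.re → 0 ≤ s.im →
      DifferentiableAt ℂ (fun s : ℂ => Complex.log (1 + a * s)) s :=
    fun s h _ => differentiableAt_log_one_add_mul ha h
  have hC : ∀ s : ℂ, 0 ≤ s.re → 0 ≤ s.im →
      ‖(fun s : ℂ => Complex.log (1 + a * s)) s‖ ≤ 40 * (1 + a) * (1 + ‖s‖) :=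
    fun s h _ => norm_log_one_add_mul_le ha h
  have h := integral_quadrant_boundary_re hF hC
  have i1 := (integrableOn_quadrant_real hF hC).re
  have i2 := (integrableOn_quadrant_imag hF hC).re
  simp only [RCLike.re_to_complex, real_smul, re_ofReal_mul, smul_eq_mul] at h i1 i2
  rw [← integral_add i1 i2] at h
  rw [← two_mul_log_one_add_mul_zetaEight_re]
  calc _ = _ := setIntegral_congr_fun measurableSet_Ioi fun s hs => by
        simp only [xi_sq_mul_sq ha (mem_Ioi.1 hs).le, smul_eq_mul, mul_add]
    _ = _ := h
    _ = _ := by ring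

theorem integral_xi_sq_le (ha : 0 < a) :
    ∫ s in Ioi 0, sqrtCauchyWeight s • xi (a ^ 2 * s ^ 2) ^ 2 ≤
      2 * (∫ s in Ioi 0, sqrtCauchyWeight s • Real.arctan (a * s) ^ 2) +
        Real.pi / 2 * Real.log (1 + Real.sqrt 2 * a + a ^ 2) ^ 2 := by
  have hF : ∀ s : ℂ, 0 ≤ s.re → 0 ≤ s.im →
      DifferentiableAt ℂ (fun s : ℂ => Complex.log (1 + a * s) ^ 2) s :=
    fun s h _ => (differentiableAt_log_one_add_mul ha h).pow 2
  have hC : ∀ s : ℂ, 0 ≤ s.re → 0 ≤ s.im →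
      ‖(fun s : ℂ => Complex.log (1 + a * s) ^ 2) s‖ ≤ 40 * (1 + a) * (1 + ‖s‖) :=
    fun s h _ => by simpa using norm_log_one_add_mul_sq_le ha h
  have h := integral_quadrant_boundary_re hF hC
  have i1 := (integrableOn_quadrant_real hF hC).re
  have i2 := (integrableOn_quadrant_imag hF hC).re
  have i3 := integrableOn_arctan_sq a
  simp only [RCLike.re_to_complex, real_smul, re_ofReal_mul, smul_eq_mul] at h i1 i2 i3
  rw [← integral_add i1 i2] at h
  have hle : (Complex.log (1 + a * zetaEight) ^ 2).re ≤
      (Complex.log (1 + a * zetaEight)).re ^ 2 := by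
    rw [pow_two, mul_re]
    nlinarith [mul_self_nonneg (Complex.log (1 + a * zetaEight)).im]
  -- Pointwise `(u+v)² ≤ 2(u²+v²)`; the `arctan²` term restores what `Re F(is)²` lacks from `v²`.
  have hmono : ∫ s in Ioi 0, sqrtCauchyWeight s • xi (a ^ 2 * s ^ 2) ^ 2 ≤
      ∫ s in Ioi (0 : ℝ), (2 * (sqrtCauchyWeight s * (Complex.log (1 + a * s) ^ 2).re +
        sqrtCauchyWeight s * (Complex.log (1 + a * (s * I)) ^ 2).re) +
        2 * (sqrtCauchyWeight s * Real.arctan (a * s) ^ 2)) := by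
    refine setIntegral_mono_on (integrableOn_xi_sq ha)
      (((i1.add i2).const_mul 2).add (i3.const_mul 2)) measurableSet_Ioi fun s hs => ?_
    have hs0 := (mem_Ioi.1 hs).le
    have e1 : (Complex.log (1 + a * s) ^ 2).re = (Complex.log (1 + a * s)).re ^ 2 := by
      have : Complex.log (1 + a * s) = (Real.log (1 + a * s) : ℝ) := by
        rw [ofReal_log (by positivity)]
        push_cast
        rfl
      rw [this, ← ofReal_pow, ofReal_re, ofReal_re]
    have e2 : (Complex.log (1 + a * (s * I)) ^ 2).re =
        (Complex.log (1 + a * (s * I))).re ^ 2 - Real.arctan (a * s) ^ 2 := by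
      rw [← log_one_add_ofReal_mul_I_im (a * s), pow_two, mul_re, ofReal_mul, mul_assoc]
      ring
    rw [e1, e2, xi_sq_mul_sq ha hs0, smul_eq_mul]
    have hw := sqrtCauchyWeight_nonneg hs0
    nlinarith [mul_nonneg hw (sq_nonneg
      ((Complex.log (1 + a * s)).re - (Complex.log (1 + a * (s * I))).re))]
  have i12 : IntegrableOn (fun s : ℝ =>
      2 * (sqrtCauchyWeight s * (Complex.log (1 + a * s) ^ 2).re +
        sqrtCauchyWeight s * (Complex.log (1 + a * (s * I)) ^ 2).re)) (Ioi 0) :=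
    (i1.add i2).const_mul 2
  refine hmono.trans ?_
  rw [integral_add i12 (i3.const_mul 2), integral_const_mul,
    integral_const_mul, h, ← two_mul_log_one_add_mul_zetaEight_re]
  simp only [smul_eq_mul]
  nlinarith [mul_le_mul_of_nonneg_left hle Real.pi_pos.le]

end

/-! ### Bounding the expectation of `log(1+λ|X|)` -/

section

variable {a : ℝ}

/-- With `u = √t`, the cubic Taylor bound for `exp u` exceeds `1 + u²` by `(u/6)((u - 3/2)² +
15/4)`. -/
theorem log_one_add_le_sqrt {t : ℝ} (ht : 0 ≤ t) : Real.log (1 + t) ≤ Real.sqrt t := by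
  rw [Real.log_le_iff_le_exp (by positivity)]
  have h2 := Real.sum_le_exp_of_nonneg (Real.sqrt_nonneg t) 4
  have h3 := Real.sq_sqrt ht
  simp [Finset.sum_range_succ, Nat.factorial] at h2
  have h0 := Real.sqrt_nonneg t
  nlinarith [mul_nonneg h0 (sq_nonneg (Real.sqrt t - 3 / 2))]

theorem log_one_add_mul_sq_le (ha : 0 < a) {s : ℝ} (hs : 0 ≤ s) :
    Real.log (1 + a ^ 2 * s ^ 2) ≤ a * s := by
  have h := log_one_add_le_sqrt (t := (a * s) ^ 2) (by positivity)
  rwa [Real.sqrt_sq (by positivity), mul_pow] at h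

theorem integrableOn_log_one_add_mul_sq (ha : 0 < a) :
    IntegrableOn (fun s => sqrtCauchyWeight s • Real.log (1 + a ^ 2 * s ^ 2)) (Ioi 0) := by
  refine integrableOn_sqrtCauchyWeight_smul (C := a)
    (ContinuousOn.log (by fun_prop) fun s _ => by positivity) (fun s hs => ?_)
  rw [Real.norm_of_nonneg (Real.log_nonneg (by nlinarith [sq_nonneg (a * s)]))]
  linarith [log_one_add_mul_sq_le ha hs]

theorem integral_sqrtCauchyWeight_mul_sq (b : ℝ) :
    ∫ s in (0 : ℝ)..b, sqrtCauchyWeight s * s ^ 2 = 1 / 2 * Real.log (1 + b ^ 4) := by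
  have hd : ∀ s : ℝ, HasDerivAt (fun s => 1 / 2 * Real.log (1 + s ^ 4))
      (sqrtCauchyWeight s * s ^ 2) s := fun s => by
    refine (((hasDerivAt_pow 4 s).const_add 1).log (by positivity)).const_mul (1 / 2)
      |>.congr_deriv ?_
    unfold sqrtCauchyWeight
    push_cast
    ring
  rw [intervalIntegral.integral_eq_sub_of_hasDerivAt (fun s _ => hd s)
    ((continuous_sqrtCauchyWeight.mul (continuous_pow 2)).intervalIntegrable _ _)]
  simp

theorem integral_Ioi_log_one_add_le (ha : 0 < a) :
    ∫ s in Ioi a⁻¹, sqrtCauchyWeight s • Real.log (1 + a ^ 2 * s ^ 2) ≤ 2 * a ^ 2 := by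
  have hb : 0 < a⁻¹ := by positivity
  have hi := (integrableOn_Ioi_rpow_of_lt (by norm_num : (-2 : ℝ) < -1) hb).const_mul (2 * a)
  have hval : ∫ s in Ioi a⁻¹, 2 * a * s ^ (-2 : ℝ) = 2 * a ^ 2 := by
    rw [integral_const_mul, integral_Ioi_rpow_of_lt (by norm_num) hb]
    norm_num
    rw [Real.rpow_neg_one]
    field_simp
  rw [← hval]
  refine setIntegral_mono_on ((integrableOn_log_one_add_mul_sq ha).mono_set
    (Ioi_subset_Ioi hb.le)) hi measurableSet_Ioi fun s hs => ?_
  have hs0 : 0 < s := hb.trans hs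
  have h := log_one_add_mul_sq_le ha hs0.le
  calc sqrtCauchyWeight s • Real.log (1 + a ^ 2 * s ^ 2) ≤ sqrtCauchyWeight s * (a * s) :=
        mul_le_mul_of_nonneg_left h (sqrtCauchyWeight_nonneg hs0.le)
    _ = 2 * a * (s ^ 2 / (1 + s ^ 4)) := by unfold sqrtCauchyWeight; ring
    _ ≤ 2 * a * s ^ (-2 : ℝ) := by
        gcongr
        rw [Real.rpow_neg hs0.le, Real.rpow_two, div_le_iff₀ (by positivity)]
        field_simp
        linarith

/-- The range is split at `as = 1`: below, `log(1+a²s²) ≤ a²s²` integrates exactly; above, the bound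
`as` keeps the tail integrable. -/
theorem integral_log_one_add_le (ha : 0 < a) :
    ∫ s in Ioi 0, sqrtCauchyWeight s • Real.log (1 + a ^ 2 * s ^ 2) ≤
      a ^ 2 / 2 * Real.log (1 + a⁻¹ ^ 4) + 2 * a ^ 2 := by
  have hb : 0 < a⁻¹ := by positivity
  have hi := integrableOn_log_one_add_mul_sq ha
  have hcont : Continuous fun s => sqrtCauchyWeight s • Real.log (1 + a ^ 2 * s ^ 2) :=
    continuous_sqrtCauchyWeight.smul (Continuous.log (by fun_prop) fun s => by positivity)
  rw [← intervalIntegral.integral_interval_add_Ioi hi (hi.mono_set (Ioi_subset_Ioi hb.le))]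
  refine add_le_add ?_ (integral_Ioi_log_one_add_le ha)
  have h : ∫ s in (0 : ℝ)..a⁻¹, a ^ 2 * (sqrtCauchyWeight s * s ^ 2) =
      a ^ 2 / 2 * Real.log (1 + a⁻¹ ^ 4) := by
    rw [intervalIntegral.integral_const_mul, integral_sqrtCauchyWeight_mul_sq]
    ring
  rw [← h]
  refine intervalIntegral.integral_mono_on hb.le (hcont.intervalIntegrable _ _)
    ((continuous_const.mul
      (continuous_sqrtCauchyWeight.mul (continuous_pow 2))).intervalIntegrable _ _)
    fun s hs => ?_
  have hlog := Real.log_le_sub_one_of_pos (by positivity : 0 < 1 + a ^ 2 * s ^ 2)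
  have hw := sqrtCauchyWeight_nonneg hs.1
  rw [smul_eq_mul]
  nlinarith

end

/-! ### Explicit bounds and conclusion -/

/-- This is what part 2 requires once the logarithm and one `4/π` are cancelled. With `√(2l) ≥ l`
and `4/π ≤ 32/25` it becomes polynomial; at `l = 1` it reads `3.92 ≤ 4`, without the cubic term. -/
theorem rational_bound_of_le_one {l : ℝ} (h0 : 0 < l) (h1 : l ≤ 1) :
    4 / Real.pi * (1 + l ^ 2 / 2) + 2 ≤
      l + 8 / (1 + l) ^ 2 + 2 * l * (Real.sqrt (2 * l) / (1 + l)) + l ^ 3 / 4 := by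
  have hs : l ≤ Real.sqrt (2 * l) := Real.le_sqrt_of_sq_le (by nlinarith)
  have hp : 4 / Real.pi ≤ 32 / 25 := by
    rw [div_le_div_iff₀ Real.pi_pos (by norm_num)]
    linarith [Real.pi_gt_d2]
  have hA : 4 / Real.pi * (1 + l ^ 2 / 2) ≤ 32 / 25 * (1 + l ^ 2 / 2) := by gcongr
  have hB : 2 * l * (l / (1 + l)) ≤ 2 * l * (Real.sqrt (2 * l) / (1 + l)) := by gcongr
  have hC : 32 / 25 * (1 + l ^ 2 / 2) + 2 ≤ l + 8 / (1 + l) ^ 2 + 2 * l * (l / (1 + l)) := by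
    rw [← sub_nonneg]
    have e : l + 8 / (1 + l) ^ 2 + 2 * l * (l / (1 + l)) - (32 / 25 * (1 + l ^ 2 / 2) + 2) =
        (8 + 2 * l ^ 2 * (1 + l) + (l - 82 / 25 - 16 / 25 * l ^ 2) * (1 + l) ^ 2) /
          (1 + l) ^ 2 := by
      field_simp
      ring
    rw [e]
    refine div_nonneg ?_ (by positivity)
    have h2 : 0 ≤ 1 - l := by linarith
    nlinarith [mul_nonneg h0.le h2, mul_nonneg (mul_nonneg h0.le h0.le) h2,
      mul_nonneg (mul_nonneg h0.le h0.le) (mul_nonneg h0.le h2)]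
  have : 0 ≤ l ^ 3 / 4 := by positivity
  linarith

theorem mainTheorem4 {Ω : Type*} [MeasurableSpace Ω] (P : Measure Ω) [IsProbabilityMeasure P]
    (X : Ω → ℝ) (hX : HasLaw X (cauchyMeasure 0 1) P) (lam : ℝ) (hlam : 0 < lam) :
    -- the expectations involved are finite
    Integrable (fun ω => xi (lam * |X ω|)) P ∧
    Integrable (fun ω => xi (lam * |X ω|) ^ 2) P ∧
    Integrable (fun ω => Real.log (1 + lam * |X ω|)) P ∧
    -- the intermediate bound on the second moment, for every `lam > 0`
    (∫ ω, xi (lam * |X ω|) ^ 2 ∂P ≤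
      min (2 * ∫ ω, Real.log (1 + lam * |X ω|) ∂P) (Real.pi ^ 2 / 2)
        + (∫ ω, xi (lam * |X ω|) ∂P) ^ 2) ∧
    -- the explicit bound for `0 < lam ≤ 1`
    (lam ≤ 1 →
      (∫ ω, xi (lam * |X ω|) ^ 2 ∂P) / lam ≤
        lam + 4 / Real.pi - 4 / Real.pi * Real.log lam + 8 / (1 + lam) ^ 2
          + 2 * lam * (Real.sqrt (2 * lam) / (1 + lam)) + lam ^ 3 / 4) ∧
    -- the explicit bound for `lam ≥ 1`
    (1 ≤ lam →
      (∫ ω, xi (lam * |X ω|) ^ 2 ∂P) / lam ≤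
        Real.pi ^ 2 / 2 + 2 + lam * Real.sqrt 2 + lam ^ 3 / 4) := by
  obtain ⟨a, ha, rfl⟩ : ∃ a : ℝ, 0 < a ∧ a ^ 2 = lam :=
    ⟨Real.sqrt lam, Real.sqrt_pos.2 hlam, Real.sq_sqrt hlam.le⟩
  have hpi := Real.pi_pos
  have e1 := integral_comp_abs_cauchy hX (f := fun t => xi (a ^ 2 * t))
    (measurable_xi.comp (by fun_prop))
  have e2 := integral_comp_abs_cauchy hX (f := fun t => xi (a ^ 2 * t) ^ 2)
    ((measurable_xi.comp (by fun_prop)).pow_const 2)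
  have e3 := integral_comp_abs_cauchy hX (f := fun t => Real.log (1 + a ^ 2 * t)) (by fun_prop)
  have hmean : ∫ ω, xi (a ^ 2 * |X ω|) ∂P = Real.log (1 + Real.sqrt 2 * a + a ^ 2) := by
    rw [e1, integral_xi ha]
    field_simp
  have harctan1 : ∫ s in Ioi 0, sqrtCauchyWeight s • Real.arctan (a * s) ^ 2 ≤
      ∫ s in Ioi 0, sqrtCauchyWeight s • Real.log (1 + a ^ 2 * s ^ 2) := by
    refine setIntegral_mono_on (integrableOn_arctan_sq a) (integrableOn_log_one_add_mul_sq ha)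
      measurableSet_Ioi fun s hs => ?_
    have hs0 := (mem_Ioi.1 hs).le
    rw [← mul_pow]
    exact mul_le_mul_of_nonneg_left (arctan_sq_le_log_one_add_sq (by positivity))
      (sqrtCauchyWeight_nonneg hs0)
  have harctan2 : ∫ s in Ioi 0, sqrtCauchyWeight s • Real.arctan (a * s) ^ 2 ≤
      Real.pi / 2 * (Real.pi ^ 2 / 4) := by
    rw [← integral_sqrtCauchyWeight, ← integral_mul_const]
    refine setIntegral_mono_on (integrableOn_arctan_sq a)
      (integrableOn_sqrtCauchyWeight.mul_const _) measurableSet_Ioi fun s hs => ?_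
    refine mul_le_mul_of_nonneg_left ?_ (sqrtCauchyWeight_nonneg (mem_Ioi.1 hs).le)
    have h := sq_le_sq' (Real.neg_pi_div_two_lt_arctan (a * s)).le
      (Real.arctan_lt_pi_div_two (a * s)).le
    linarith
  have hsecond : ∫ ω, xi (a ^ 2 * |X ω|) ^ 2 ∂P ≤
      min (2 * ∫ ω, Real.log (1 + a ^ 2 * |X ω|) ∂P) (Real.pi ^ 2 / 2)
        + (∫ ω, xi (a ^ 2 * |X ω|) ∂P) ^ 2 := by
    have h := mul_le_mul_of_nonneg_left (integral_xi_sq_le ha) (by positivity : 0 ≤ 2 / Real.pi)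
    have h' : 2 / Real.pi * (Real.pi / 2 * Real.log (1 + Real.sqrt 2 * a + a ^ 2) ^ 2) =
        Real.log (1 + Real.sqrt 2 * a + a ^ 2) ^ 2 := by field_simp
    rw [mul_add, h'] at h
    rw [e2, hmean]
    refine h.trans (add_le_add_left (le_min ?_ ?_) _)
    · rw [e3]
      have := mul_le_mul_of_nonneg_left harctan1 (by positivity : 0 ≤ 2 / Real.pi)
      linarith
    · have h1 := mul_le_mul_of_nonneg_left harctan2 (by positivity : 0 ≤ 2 / Real.pi)
      have h2 : 2 / Real.pi * (Real.pi / 2 * (Real.pi ^ 2 / 4)) = Real.pi ^ 2 / 4 := by field_simp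
      linarith
  have hmean_sq : (∫ ω, xi (a ^ 2 * |X ω|) ∂P) ^ 2 ≤ 2 * a ^ 2 := by
    have h2 : Real.sqrt 2 ^ 2 = 2 := Real.sq_sqrt (by norm_num)
    have h0 : 0 ≤ Real.sqrt 2 * a := by positivity
    -- At `x = √2 a`, `1 + x + x²/2` is exactly the argument of the logarithm, so `μ ≤ √2 a`.
    have h1 := Real.quadratic_le_exp_of_nonneg h0
    have hle : Real.log (1 + Real.sqrt 2 * a + a ^ 2) ≤ Real.sqrt 2 * a := by
      rw [Real.log_le_iff_le_exp (by positivity)]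
      rw [mul_pow, h2] at h1
      linarith
    have hge : 0 ≤ Real.log (1 + Real.sqrt 2 * a + a ^ 2) := Real.log_nonneg (by nlinarith)
    rw [hmean]
    calc _ ≤ (Real.sqrt 2 * a) ^ 2 := by gcongr
      _ = 2 * a ^ 2 := by rw [mul_pow, h2]
  refine ⟨integrable_comp_abs_cauchy hX (f := fun t => xi (a ^ 2 * t)) (integrableOn_xi ha),
    integrable_comp_abs_cauchy hX (f := fun t => xi (a ^ 2 * t) ^ 2) (integrableOn_xi_sq ha),
    integrable_comp_abs_cauchy hX (f := fun t => Real.log (1 + a ^ 2 * t))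
      (integrableOn_log_one_add_mul_sq ha), hsecond, fun hle => ?_, fun hge => ?_⟩
  · have h1 := hsecond.trans (add_le_add (min_le_left _ _) hmean_sq)
    have hlog : Real.log (1 + a⁻¹ ^ 4) ≤ (a ^ 2) ^ 2 - 2 * Real.log (a ^ 2) := by
      have e : 1 + a⁻¹ ^ 4 = (1 + (a ^ 2) ^ 2) / (a ^ 2) ^ 2 := by field_simp; ring
      rw [e, Real.log_div (by positivity) (by positivity), Real.log_pow (a ^ 2) 2]
      have := Real.log_le_sub_one_of_pos (by positivity : 0 < 1 + (a ^ 2) ^ 2)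
      push_cast
      linarith
    have h2 := (integral_log_one_add_le ha).trans
      (add_le_add_left (mul_le_mul_of_nonneg_left hlog (by positivity)) _)
    have h3 := mul_le_mul_of_nonneg_left h2 (by positivity : 0 ≤ 2 / Real.pi)
    rw [← e3] at h3
    rw [div_le_iff₀ (by positivity)]
    have hbound := mul_le_mul_of_nonneg_right (rational_bound_of_le_one hlam hle) hlam.le
    -- The tail contributes `8/π` after division by `λ`: one `4/π` appears in the claim, the other
    -- goes to `rational_bound_of_le_one`.
    have hsplit : 2 * (2 / Real.pi *
        (a ^ 2 / 2 * ((a ^ 2) ^ 2 - 2 * Real.log (a ^ 2)) + 2 * a ^ 2)) =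
        (4 / Real.pi * (1 + (a ^ 2) ^ 2 / 2)) * a ^ 2 +
          (4 / Real.pi - 4 / Real.pi * Real.log (a ^ 2)) * a ^ 2 := by ring
    linarith
  · have h1 := hsecond.trans (add_le_add (min_le_right _ _) hmean_sq)
    rw [div_le_iff₀ (by positivity)]
    have h2 : 0 ≤ Real.sqrt 2 := Real.sqrt_nonneg 2
    have h3 : 0 ≤ (a ^ 2 * Real.sqrt 2 + (a ^ 2) ^ 3 / 4) * a ^ 2 := by positivity
    -- `π²/2 ≤ λπ²/2`; the terms in `h3` are pure slack.
    nlinarith [mul_le_mul_of_nonneg_left hge (by positivity : 0 ≤ Real.pi ^ 2 / 2)]
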